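/- **Theorem.** Let $p,u,v>1$ be integers, and let $e,f$ be rational numbers such that $eu-1$ and $fv-1$ are non-negative integers. For real $z,q$ write $(z;q)_0=1$ and $(z;q)_n=\prod_{k=0}^{n-1}(1-zq^k)$ for $n\ge 1$. Then the infinite continued fraction $$[0;\overline{p-1,\,1,\,eu^n-1,\,p-1,\,1,\,fv^n-1}\,]_{n=1}^{\infty}$$ (the six displayed partial quotients are listed for $n=1$, then for $n=2$, and so on; its value is the limit of its convergents) converges, the two series below converge, the series in the denominator is non-zero, and $$[0;\overline{p-1,1,eu^n-1,p-1,1,fv^n-1}\,]_{n=1}^{\infty} =\frac1p+\left(\frac{1}{ep^2u}-\frac{1}{e^2fp^4u^2v+ep^2}\; \frac{\displaystyle\sum_{n=0}^{\infty}\frac{(efp^2)^{-n}(uv)^{-n(n+3)/2}}{\left(\frac1{uv};\frac1{uv}\right)_n\left(-\frac{1}{efp^2u^3v^2};\frac1{uv}\right)_n}} {\displaystyle\sum_{n=0}^{\infty}\frac{(efp^2)^{-n}(uv)^{-n(n+1)/2}}{\left(\frac1{uv};\frac1{uv}\right)_n\left(-\frac{1}{efp^2u^2v};\frac1{uv}\right)_n}}\right).$$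 -/

import Mathlib

open Filter Topology

noncomputable section

/-- The infinite continued fraction `[b₀; b 0, b 1, b 2, …]` with all partial numerators `1`. -/
def infContFrac (b₀ : ℝ) (b : ℕ → ℝ) : GenContFract ℝ :=
  ⟨b₀, Stream'.Seq.ofStream (fun n => (⟨1, b n⟩ : GenContFract.Pair ℝ))⟩

/-- A continued fraction converges to `x`: its convergents `Aₙ / Bₙ` tend to `x`. -/
def GenContFract.ConvergesTo (g : GenContFract ℝ) (x : ℝ) : Prop :=
  Tendsto (fun n : ℕ => g.convs n) atTop (𝓝 x)

/-- The `q`-product `(z; q)_n = ∏_{k < n} (1 - z q ^ k)`. -/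
def qProd (z q : ℝ) (n : ℕ) : ℝ :=
  ∏ k ∈ Finset.range n, (1 - z * q ^ k)

/-- The partial quotients `p - 1, 1, e uⁿ - 1, p - 1, 1, f vⁿ - 1`, concatenated for
`n = 1, 2, 3, …`. -/
def tasoevQuotient (p u v : ℕ) (e f : ℚ) (k : ℕ) : ℝ :=
  let n := k / 6 + 1
  match k % 6 with
  | 0 => (p : ℝ) - 1
  | 1 => 1
  | 2 => (e : ℝ) * (u : ℝ) ^ n - 1
  | 3 => (p : ℝ) - 1
  | 4 => 1
  | _ => (f : ℝ) * (v : ℝ) ^ n - 1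

/-- `(ef)⁻ⁿ (uv)^{-n(n+3)/2} / ((1/uv; 1/uv)_n (-1/(e f u³ v²); 1/uv)_n)`
(`n(n+3)` is even, so the division of natural numbers is exact). -/
def numTerm (e f u v : ℝ) (n : ℕ) : ℝ :=
  ((e * f) ^ n)⁻¹ * ((u * v) ^ (n * (n + 3) / 2))⁻¹ /
    (qProd (1 / (u * v)) (1 / (u * v)) n *
      qProd (-1 / (e * f * u ^ 3 * v ^ 2)) (1 / (u * v)) n)

/-- `(ef)⁻ⁿ (uv)^{-n(n+1)/2} / ((1/uv; 1/uv)_n (-1/(e f u² v); 1/uv)_n)`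
(`n(n+1)` is even, so the division of natural numbers is exact). -/
def denTerm (e f u v : ℝ) (n : ℕ) : ℝ :=
  ((e * f) ^ n)⁻¹ * ((u * v) ^ (n * (n + 1) / 2))⁻¹ /
    (qProd (1 / (u * v)) (1 / (u * v)) n *
      qProd (-1 / (e * f * u ^ 2 * v)) (1 / (u * v)) n)

end

/-! ### Convergence of continued fractions from a sequence of positive tails -/

/-! Each block `p - 1, 1, x - 1` collapses because `1 / (1 + 1 / (X - 1)) = 1 - 1 / X`
(`tasoev_block`), so the fraction equals `1/p + [0; E u, f v, E u², f v², …]` with `E = e p²`. With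
`q = 1/(uv)`, two contiguous relations linking `(a, c)` to `(a q, c q)` (`qHyp_sub_qHypTilt`,
`one_sub_mul_qHypTilt`) show that the quotient `tasoevTail` of `q`-series obeys the recursion of the
simpler fraction (`tasoevTail_rec`). A solution of the recursion alone does not give convergence;
positivity of the tails and divergence of the sum of partial quotients do
(`infContFrac_convergesTo_of_tails`). The first contiguous relation then turns `tasoevTail` into the
stated difference. -/

lemma infContFrac_contsAux_rec (b₀ : ℝ) (b : ℕ → ℝ) (n : ℕ) :
    ((infContFrac b₀ b).contsAux (n + 2)).a =
        b n * ((infContFrac b₀ b).contsAux (n + 1)).a + ((infContFrac b₀ b).contsAux n).a ∧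
      ((infContFrac b₀ b).contsAux (n + 2)).b =
        b n * ((infContFrac b₀ b).contsAux (n + 1)).b + ((infContFrac b₀ b).contsAux n).b := by
  have hs : (infContFrac b₀ b).s.get? n = some ⟨1, b n⟩ := rfl
  have h := GenContFract.contsAux_recurrence hs rfl rfl
  rw [h]
  simp

/-- If `T n = b n + 1 / T (n + 1)` with positive tails `T` and non-negative partial quotients whose
sum diverges, then `[0; b 0, b 1, …]` converges to `1 / T 0`. -/
lemma infContFrac_convergesTo_of_tails (b T : ℕ → ℝ) (hb : ∀ n, 0 ≤ b n) (hb0 : 1 ≤ b 0)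
    (hT : ∀ n, 0 < T n) (hrec : ∀ n, T n = b n + 1 / T (n + 1))
    (hsum : Tendsto (fun n => ∑ k ∈ Finset.range n, b k) atTop atTop) :
    (infContFrac 0 b).ConvergesTo (1 / T 0) := by
  set A : ℕ → ℝ := fun n => ((infContFrac 0 b).contsAux n).a with hAdef
  set B : ℕ → ℝ := fun n => ((infContFrac 0 b).contsAux n).b with hBdef
  have hA : ∀ n, A (n + 2) = b n * A (n + 1) + A n := fun n =>
    (infContFrac_contsAux_rec 0 b n).1
  have hB : ∀ n, B (n + 2) = b n * B (n + 1) + B n := fun n =>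
    (infContFrac_contsAux_rec 0 b n).2
  have hA0 : A 0 = 1 := rfl
  have hA1 : A 1 = 0 := rfl
  have hB0 : B 0 = 0 := rfl
  have hB1 : B 1 = 1 := rfl
  have hBone : ∀ n, 1 ≤ B (n + 1) ∧ 1 ≤ B (n + 2) := by
    intro n
    induction n with
    | zero => exact ⟨hB1.ge, by rw [hB, hB1, hB0]; linarith⟩
    | succ n ih =>
      refine ⟨ih.2, ?_⟩
      rw [hB]
      nlinarith [hb (n + 1), ih.1, ih.2, mul_nonneg (hb (n + 1)) (zero_le_one.trans ih.2)]
  have hBnn : ∀ n, 0 ≤ B n := by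
    rintro (_ | n)
    · exact hB0.ge
    · exact zero_le_one.trans (hBone n).1
  -- The Möbius map of the first `n` quotients sends the tail `T n` to the full value `1 / T 0`.
  have htail : ∀ n, 1 / T 0 * (B (n + 1) * T n + B n) = A (n + 1) * T n + A n := by
    intro n
    induction n with
    | zero =>
      have := (hT 0).ne'
      rw [hA0, hA1, hB0, hB1]
      field_simp
      ring
    | succ n ih =>
      have h1 := (hT (n + 1)).ne'
      have h2 : T n * T (n + 1) = b n * T (n + 1) + 1 := by
        rw [hrec n]; field_simp
      rw [hA, hB]
      linear_combination T (n + 1) * ih + (A (n + 1) - 1 / T 0 * B (n + 1)) * h2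
  have hdet : ∀ n, |A (n + 1) * B n - A n * B (n + 1)| = 1 := by
    intro n
    induction n with
    | zero => rw [hA0, hA1, hB0, hB1]; norm_num
    | succ n ih =>
      rw [← ih, ← abs_neg, hA, hB]
      congr 1
      ring
  have hgrow : ∀ n, ∑ k ∈ Finset.range n, b k ≤ B n * B (n + 1) := by
    intro n
    induction n with
    | zero => rw [hB0]; simp
    | succ n ih =>
      rw [Finset.sum_range_succ, hB]
      have h1 : 1 ≤ B (n + 1) * B (n + 1) := one_le_mul_of_one_le_of_one_le (hBone n).1 (hBone n).1
      nlinarith [mul_le_mul_of_nonneg_left h1 (hb n)]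
  have hpos : ∀ n, 0 < ∑ k ∈ Finset.range (n + 1), b k := fun n =>
    zero_lt_one.trans_le (hb0.trans (Finset.single_le_sum (fun k _ => hb k)
      (Finset.mem_range.2 n.succ_pos)))
  -- By `htail` and `hdet` the error is exactly `1 / (B (n+1) (B (n+1) T n + B n))`, and `T n ≥ b n`
  -- makes this at most `1 / (B (n+1) B (n+2))`.
  have herr : ∀ n, ‖(infContFrac 0 b).convs n - 1 / T 0‖ ≤
      (∑ k ∈ Finset.range (n + 1), b k)⁻¹ := by
    intro n
    have hconv : (infContFrac 0 b).convs n = A (n + 1) / B (n + 1) := rfl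
    have h1 := zero_lt_one.trans_le (hBone n).1
    have hTb : b n ≤ T n := by
      rw [hrec n]
      linarith [one_div_pos.2 (hT (n + 1))]
    have hle : ∑ k ∈ Finset.range (n + 1), b k ≤ B (n + 1) * (B (n + 1) * T n + B n) := by
      refine (hgrow (n + 1)).trans (mul_le_mul_of_nonneg_left ?_ h1.le)
      rw [hB]
      nlinarith [mul_le_mul_of_nonneg_left hTb h1.le]
    have hD := (hpos n).trans_le hle
    have hval : (infContFrac 0 b).convs n - 1 / T 0 =
        (A (n + 1) * B n - A n * B (n + 1)) / (B (n + 1) * (B (n + 1) * T n + B n)) := by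
      rw [hconv, eq_div_iff hD.ne']
      have h2 : A (n + 1) / B (n + 1) * B (n + 1) = A (n + 1) := div_mul_cancel₀ _ h1.ne'
      linear_combination (B (n + 1) * T n + B n) * h2 - B (n + 1) * htail n
    rw [hval, norm_div, Real.norm_eq_abs, hdet n, Real.norm_eq_abs, abs_of_pos hD, one_div]
    exact inv_anti₀ (hpos n) hle
  rw [GenContFract.ConvergesTo, tendsto_iff_norm_sub_tendsto_zero]
  exact squeeze_zero (fun n => norm_nonneg _) herr
    (tendsto_inv_atTop_zero.comp (hsum.comp (tendsto_add_atTop_nat 1)))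

/-! ### A `q`-hypergeometric series and its contiguous relations -/

lemma qProd_succ (z q : ℝ) (n : ℕ) : qProd z q (n + 1) = qProd z q n * (1 - z * q ^ n) :=
  Finset.prod_range_succ _ _

lemma qProd_succ_left (z q : ℝ) (n : ℕ) :
    qProd z q (n + 1) = (1 - z) * qProd (z * q) q n := by
  simp only [qProd]
  rw [Finset.prod_range_succ', pow_zero, mul_one, mul_comm]
  congr 1
  exact Finset.prod_congr rfl fun k _ => by ring

lemma qProd_pos {z q : ℝ} (hz : z < 1) (hq : 0 < q) (hq1 : q < 1) (n : ℕ) : 0 < qProd z q n := by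
  refine Finset.prod_pos fun k _ => ?_
  have h1 : 0 < q ^ k := pow_pos hq k
  have h2 : q ^ k ≤ 1 := pow_le_one₀ hq.le hq1.le
  nlinarith

lemma triangular_succ (n : ℕ) : (n + 1) * (n + 1 + 1) / 2 = n * (n + 1) / 2 + (n + 1) := by
  rw [show (n + 1) * (n + 1 + 1) = n * (n + 1) + (n + 1) * 2 by ring,
    Nat.add_mul_div_right _ _ two_pos]

/-- The general term `aⁿ q^{n(n+1)/2} / ((q; q)_n (c; q)_n)`. -/
noncomputable def qHypTerm (a c q : ℝ) (n : ℕ) : ℝ :=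
  a ^ n * q ^ (n * (n + 1) / 2) / (qProd q q n * qProd c q n)

section qHyp

variable {a c q : ℝ}

lemma qHypTerm_pos (ha : 0 < a) (hc : c < 0) (hq : 0 < q) (hq1 : q < 1) (n : ℕ) :
    0 < qHypTerm a c q n :=
  div_pos (mul_pos (pow_pos ha _) (pow_pos hq _))
    (mul_pos (qProd_pos hq1 hq hq1 n) (qProd_pos (hc.trans one_pos) hq hq1 n))

lemma qHypTerm_succ (n : ℕ) :
    qHypTerm a c q (n + 1) =
      qHypTerm a c q n * (a * q ^ (n + 1) / ((1 - q ^ (n + 1)) * (1 - c * q ^ n))) := by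
  simp only [qHypTerm]
  rw [triangular_succ, qProd_succ, qProd_succ, div_mul_div_comm]
  congr 1 <;> ring

lemma qHypTerm_summable (ha : 0 < a) (hc : c < 0) (hq : 0 < q) (hq1 : q < 1) :
    Summable (qHypTerm a c q) := by
  have hlim : Tendsto (fun n : ℕ => a * q ^ (n + 1) / ((1 - q ^ (n + 1)) * (1 - c * q ^ n)))
      atTop (𝓝 (a * 0 / ((1 - 0) * (1 - c * 0)))) := by
    have h0 : Tendsto (fun n : ℕ => q ^ n) atTop (𝓝 0) :=
      tendsto_pow_atTop_nhds_zero_of_lt_one hq.le hq1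
    have h1 := h0.comp (tendsto_add_atTop_nat 1)
    exact (h1.const_mul a).div ((h1.const_sub 1).mul ((h0.const_mul c).const_sub 1)) (by norm_num)
  rw [mul_zero, zero_div] at hlim
  refine summable_of_ratio_test_tendsto_lt_one zero_lt_one
    (Eventually.of_forall fun n => (qHypTerm_pos ha hc hq hq1 n).ne') (hlim.congr fun n => ?_)
  have h1 := qHypTerm_pos ha hc hq hq1 n
  have h2 := qHypTerm_pos ha hc hq hq1 (n + 1)
  rw [Real.norm_of_nonneg h1.le, Real.norm_of_nonneg h2.le, qHypTerm_succ,
    mul_div_cancel_left₀ _ h1.ne']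

lemma qHypTerm_mul_pow_summable (ha : 0 < a) (hc : c < 0) (hq : 0 < q) (hq1 : q < 1) :
    Summable fun n => qHypTerm a c q n * q ^ n :=
  (qHypTerm_summable ha hc hq hq1).of_nonneg_of_le
    (fun n => mul_nonneg (qHypTerm_pos ha hc hq hq1 n).le (pow_nonneg hq.le n))
    fun n => mul_le_of_le_one_right (qHypTerm_pos ha hc hq hq1 n).le (pow_le_one₀ hq.le hq1.le)

/-- The series `∑ aⁿ q^{n(n+1)/2} / ((q; q)_n (c; q)_n)`. -/
noncomputable def qHyp (a c q : ℝ) : ℝ := ∑' n, qHypTerm a c q n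

/-- The series `∑ aⁿ q^{n(n+3)/2} / ((q; q)_n (c; q)_n)`. -/
noncomputable def qHypTilt (a c q : ℝ) : ℝ := ∑' n, qHypTerm a c q n * q ^ n

lemma qHyp_pos (ha : 0 < a) (hc : c < 0) (hq : 0 < q) (hq1 : q < 1) : 0 < qHyp a c q :=
  (qHypTerm_summable ha hc hq hq1).tsum_pos (fun n => (qHypTerm_pos ha hc hq hq1 n).le) 0
    (qHypTerm_pos ha hc hq hq1 0)

lemma qHypTilt_pos (ha : 0 < a) (hc : c < 0) (hq : 0 < q) (hq1 : q < 1) : 0 < qHypTilt a c q :=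
  (qHypTerm_mul_pow_summable ha hc hq hq1).tsum_pos
    (fun n => (mul_pos (qHypTerm_pos ha hc hq hq1 n) (pow_pos hq n)).le) 0
    (mul_pos (qHypTerm_pos ha hc hq hq1 0) (pow_pos hq 0))

/-- The factor `1 - q ^ n` kills the term `n = 0` and cancels the last factor of `(q; q)_n`; then
the index shifts by one. -/
lemma qHyp_sub_qHypTilt (ha : 0 < a) (hc : c < 0) (hq : 0 < q) (hq1 : q < 1) :
    (1 - c) * (qHyp a c q - qHypTilt a c q) = a * q * qHyp (a * q) (c * q) q := by
  have hs := qHypTerm_summable ha hc hq hq1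
  have hs' := qHypTerm_mul_pow_summable ha hc hq hq1
  rw [qHyp, qHypTilt, ← hs.tsum_sub hs', (hs.sub hs').tsum_eq_zero_add, qHyp, ← tsum_mul_left,
    pow_zero, mul_one, sub_self, zero_add, ← tsum_mul_left]
  refine tsum_congr fun n => ?_
  have h1 : 1 - q ^ (n + 1) ≠ 0 := (sub_pos.2 (pow_lt_one₀ hq.le hq1 n.succ_ne_zero)).ne'
  have h2 : 1 - c ≠ 0 := by linarith
  have h3 := (qProd_pos hq1 hq hq1 n).ne'
  have h4 := (qProd_pos (z := c * q) (by nlinarith) hq hq1 n).ne'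
  simp only [qHypTerm]
  rw [triangular_succ, qProd_succ q, qProd_succ_left c, ← pow_succ']
  field_simp
  ring

/-- Holds term by term, from `(c; q)_n (1 - c q ^ n) = (1 - c) (c q; q)_n`. -/
lemma one_sub_mul_qHypTilt (ha : 0 < a) (hc : c < 0) (hq : 0 < q) (hq1 : q < 1) :
    (1 - c) * qHypTilt a c q = qHyp (a * q) (c * q) q - c * qHypTilt (a * q) (c * q) q := by
  have ha' : 0 < a * q := mul_pos ha hq
  have hc' : c * q < 0 := mul_neg_of_neg_of_pos hc hq
  have hs := qHypTerm_summable ha' hc' hq hq1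
  have hs' := qHypTerm_mul_pow_summable ha' hc' hq hq1
  rw [qHypTilt, qHyp, qHypTilt, ← tsum_mul_left, ← tsum_mul_left, ← hs.tsum_sub (hs'.mul_left c)]
  refine tsum_congr fun n => ?_
  have h2 := (qProd_pos (hc.trans one_pos) hq hq1 n).ne'
  have h3 := (qProd_pos hq1 hq hq1 n).ne'
  have h4 := (qProd_pos (z := c * q) (by linarith) hq hq1 n).ne'
  have h5 : qProd c q n * (1 - c * q ^ n) = (1 - c) * qProd (c * q) q n := by
    rw [← qProd_succ, qProd_succ_left]
  simp only [qHypTerm]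
  field_simp
  linear_combination (-(a ^ n * q ^ n)) * h5

end qHyp

/-! ### The continued fraction `[0; E u, f v, E u², f v², …]` -/

/-- The value of `[0; E u, f v, E u², f v², …]` as a quotient of `q`-series. -/
noncomputable def tasoevTail (E f u v : ℝ) : ℝ :=
  qHypTilt (1 / (E * f)) (-1 / (E * f * u ^ 2 * v)) (1 / (u * v)) /
    (E * u * qHyp (1 / (E * f)) (-1 / (E * f * u ^ 2 * v)) (1 / (u * v)))

section tail

variable {E f u v : ℝ}

lemma tasoev_params (hE : 0 < E) (hf : 0 < f) (hu : 1 < u) (hv : 1 < v) :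
    0 < 1 / (E * f) ∧ -1 / (E * f * u ^ 2 * v) < 0 ∧ 0 < 1 / (u * v) ∧ 1 / (u * v) < 1 := by
  have hu0 := one_pos.trans hu
  have hv0 := one_pos.trans hv
  refine ⟨by positivity, div_neg_of_neg_of_pos (by norm_num) (by positivity), by positivity, ?_⟩
  rw [div_lt_one (by positivity)]
  nlinarith

lemma tasoevTail_pos (hE : 0 < E) (hf : 0 < f) (hu : 1 < u) (hv : 1 < v) :
    0 < tasoevTail E f u v := by
  obtain ⟨h1, h2, h3, h4⟩ := tasoev_params hE hf hu hv
  exact div_pos (qHypTilt_pos h1 h2 h3 h4)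
    (mul_pos (mul_pos hE (one_pos.trans hu)) (qHyp_pos h1 h2 h3 h4))

/-- Passing to the tail `(E u, f v)` is the shift `(a, c) ↦ (a q, c q)` of the contiguous relations.
-/
lemma tasoev_params_shift (hE : 0 < E) (hf : 0 < f) (hu : 1 < u) (hv : 1 < v) :
    1 / (E * u * (f * v)) = 1 / (E * f) * (1 / (u * v)) ∧
      -1 / (E * u * (f * v) * u ^ 2 * v) = -1 / (E * f * u ^ 2 * v) * (1 / (u * v)) := by
  have hu0 := one_pos.trans hu
  have hv0 := one_pos.trans hv
  constructor <;> field_simp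

lemma tasoevTail_rec (hE : 0 < E) (hf : 0 < f) (hu : 1 < u) (hv : 1 < v) :
    tasoevTail E f u v = 1 / (E * u + 1 / (f * v + tasoevTail (E * u) (f * v) u v)) := by
  have hu0 := one_pos.trans hu
  have hv0 := one_pos.trans hv
  have hK := tasoevTail_pos (mul_pos hE hu0) (mul_pos hf hv0) hu hv
  obtain ⟨ha, hc, hq, hq1⟩ := tasoev_params hE hf hu hv
  have hii := qHyp_sub_qHypTilt ha hc hq hq1
  have hi := one_sub_mul_qHypTilt ha hc hq hq1
  have hG := qHyp_pos ha hc hq hq1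
  have hG' := qHyp_pos (mul_pos ha hq) (mul_neg_of_neg_of_pos hc hq) hq hq1
  rw [eq_div_iff (by positivity), tasoevTail, tasoevTail, (tasoev_params_shift hE hf hu hv).1,
    (tasoev_params_shift hE hf hu hv).2]
  have hP' := qHypTilt_pos (mul_pos ha hq) (mul_neg_of_neg_of_pos hc hq) hq hq1
  generalize qHyp (1 / (E * f)) _ _ = G at *
  generalize qHypTilt (1 / (E * f)) _ _ = P at *
  generalize qHyp _ _ _ = G' at *
  generalize qHypTilt _ _ _ = P' at *
  have h1 : (E * f * u ^ 2 * v + 1) * P = E * f * u ^ 2 * v * G' + P' := by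
    field_simp at hi
    linear_combination hi
  have h2 : (E * f * u ^ 2 * v + 1) * (G - P) = u * G' := by
    field_simp at hii
    linear_combination hii
  have h3 : 1 / (f * v + P' / (E * u * u * G')) =
      E * u ^ 2 * G' / (E * f * u ^ 2 * v * G' + P') := by
    field_simp
  rw [h3]
  field_simp
  -- The goal amounts to `P u G' = (G - P) (E f u² v G' + P')`; both sides equal `(E f u² v + 1) P
  -- (G - P)`.
  linear_combination (G - P) * h1 - P * h2

end tail

/-! ### The Tasoev continued fraction -/

/-- The tail at `p - 1`, of the block `p - 1, 1, x - 1`, in terms of `y = [0; p² x, …]`. -/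
lemma tasoev_block {p x L : ℝ} (hp : 0 < p) (hx : 1 ≤ x) (hL : 0 < L) :
    1 / (1 / p + 1 / (p ^ 2 * x + L)) =
      p - 1 + 1 / (1 + 1 / (x - 1 + (1 / p + L / p ^ 2))) := by
  have hx' := one_pos.trans_le hx
  have hw : 0 < x - 1 + (1 / p + L / p ^ 2) :=
    add_pos_of_nonneg_of_pos (sub_nonneg.2 hx) (by positivity)
  have hX : 0 < x + (1 / p + L / p ^ 2) := by positivity
  have h : 1 / (1 + 1 / (x - 1 + (1 / p + L / p ^ 2))) = 1 - 1 / (x + (1 / p + L / p ^ 2)) := by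
    generalize 1 / p + L / p ^ 2 = y at *
    have : 1 + 1 / (x - 1 + y) = (x + y) / (x - 1 + y) := by
      rw [eq_div_iff hw.ne', add_mul, one_div_mul_cancel hw.ne']
      ring
    rw [this, one_div_div, eq_sub_iff_add_eq, ← add_div, div_eq_one_iff_eq hX.ne']
    ring
  rw [h]
  field_simp
  ring

/-- The tails of the continued fraction with partial quotients `tasoevQuotient p u v e f`, where
`K j` and `L j` are the tails of `[0; e p² u, f v, e p² u², f v², …]`. -/
noncomputable def tasoevTails (p u v : ℕ) (e f : ℚ) (K L : ℕ → ℝ) (k : ℕ) : ℝ :=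
  let j := k / 6
  match k % 6 with
  | 0 => 1 / (1 / (p : ℝ) + K j)
  | 1 => 1 + 1 / ((e : ℝ) * (u : ℝ) ^ (j + 1) - 1 + (1 / (p : ℝ) + L j / (p : ℝ) ^ 2))
  | 2 => (e : ℝ) * (u : ℝ) ^ (j + 1) - 1 + (1 / (p : ℝ) + L j / (p : ℝ) ^ 2)
  | 3 => 1 / (1 / (p : ℝ) + L j / (p : ℝ) ^ 2)
  | 4 => 1 + 1 / ((f : ℝ) * (v : ℝ) ^ (j + 1) - 1 + (1 / (p : ℝ) + K (j + 1)))
  | _ => (f : ℝ) * (v : ℝ) ^ (j + 1) - 1 + (1 / (p : ℝ) + K (j + 1))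

lemma tasoevQuotient_six_mul_add_one (p u v : ℕ) (e f : ℚ) (j : ℕ) :
    tasoevQuotient p u v e f (6 * j + 1) = 1 := by
  simp [tasoevQuotient, show (6 * j + 1) % 6 = 1 by omega]

lemma tasoevQuotient_nonneg {p u v : ℕ} {e f : ℚ} (hp : 1 ≤ p)
    (he : ∀ j : ℕ, 1 ≤ (e : ℝ) * (u : ℝ) ^ (j + 1)) (hf : ∀ j : ℕ, 1 ≤ (f : ℝ) * (v : ℝ) ^ (j + 1))
    (k : ℕ) : 0 ≤ tasoevQuotient p u v e f k := by
  have hp' : (1 : ℝ) ≤ p := by exact_mod_cast hp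
  have h1 := he (k / 6)
  have h2 := hf (k / 6)
  simp only [tasoevQuotient]
  split <;> linarith

lemma tasoevTails_pos {p u v : ℕ} {e f : ℚ} {K L : ℕ → ℝ} (hp : 1 ≤ p)
    (he : ∀ j : ℕ, 1 ≤ (e : ℝ) * (u : ℝ) ^ (j + 1)) (hf : ∀ j : ℕ, 1 ≤ (f : ℝ) * (v : ℝ) ^ (j + 1))
    (hK : ∀ j, 0 < K j) (hL : ∀ j, 0 < L j) (k : ℕ) : 0 < tasoevTails p u v e f K L k := by
  have hp' : (0 : ℝ) < p := by exact_mod_cast hp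
  have h1 := sub_nonneg.2 (he (k / 6))
  have h2 := sub_nonneg.2 (hf (k / 6))
  have h3 := hK (k / 6)
  have h4 := hK (k / 6 + 1)
  have h5 := hL (k / 6)
  simp only [tasoevTails]
  split <;> positivity

lemma tasoevTails_rec {p u v : ℕ} {e f : ℚ} {K L : ℕ → ℝ} (hp : 1 ≤ p)
    (he : ∀ j : ℕ, 1 ≤ (e : ℝ) * (u : ℝ) ^ (j + 1)) (hf : ∀ j : ℕ, 1 ≤ (f : ℝ) * (v : ℝ) ^ (j + 1))
    (hK : ∀ j, 0 < K j) (hL : ∀ j, 0 < L j)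
    (hKL : ∀ j, K j = 1 / ((e : ℝ) * (p : ℝ) ^ 2 * (u : ℝ) ^ (j + 1) + L j))
    (hLK : ∀ j, L j = 1 / ((f : ℝ) * (v : ℝ) ^ (j + 1) + K (j + 1))) (k : ℕ) :
    tasoevTails p u v e f K L k =
      tasoevQuotient p u v e f k + 1 / tasoevTails p u v e f K L (k + 1) := by
  have hp' : (0 : ℝ) < p := by exact_mod_cast hp
  obtain ⟨j, r, hr, rfl⟩ : ∃ j r, r < 6 ∧ k = 6 * j + r :=
    ⟨k / 6, k % 6, Nat.mod_lt _ (by norm_num), (Nat.div_add_mod k 6).symm⟩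
  have hd : (6 * j + r) / 6 = j := by omega
  have hm : (6 * j + r) % 6 = r := by omega
  interval_cases r
  · have hd' : (6 * j + 0 + 1) / 6 = j := by omega
    have hm' : (6 * j + 0 + 1) % 6 = 1 := by omega
    simp only [tasoevTails, tasoevQuotient, hd, hm, hd', hm']
    rw [← tasoev_block hp' (he j) (hL j), hKL j]
    ring_nf
  · have hd' : (6 * j + 1 + 1) / 6 = j := by omega
    have hm' : (6 * j + 1 + 1) % 6 = 2 := by omega
    simp only [tasoevTails, tasoevQuotient, hd, hm, hd', hm']
  · have hd' : (6 * j + 2 + 1) / 6 = j := by omega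
    have hm' : (6 * j + 2 + 1) % 6 = 3 := by omega
    simp only [tasoevTails, tasoevQuotient, hd, hm, hd', hm', one_div_one_div]
  · have hd' : (6 * j + 3 + 1) / 6 = j := by omega
    have hm' : (6 * j + 3 + 1) % 6 = 4 := by omega
    simp only [tasoevTails, tasoevQuotient, hd, hm, hd', hm']
    -- The second block lacks the factor `p²`, so its tail is rescaled by taking `p² K (j+1)` for
    -- `L`.
    have h := tasoev_block hp' (hf j) (mul_pos (pow_pos hp' 2) (hK (j + 1)))
    rw [mul_div_cancel_left₀ _ (pow_pos hp' 2).ne', ← mul_add] at h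
    rw [← h, hLK j, div_div, mul_comm ((p : ℝ) ^ 2)]
  · have hd' : (6 * j + 4 + 1) / 6 = j := by omega
    have hm' : (6 * j + 4 + 1) % 6 = 5 := by omega
    simp only [tasoevTails, tasoevQuotient, hd, hm, hd', hm']
  · have hd' : (6 * j + 5 + 1) / 6 = j + 1 := by omega
    have hm' : (6 * j + 5 + 1) % 6 = 0 := by omega
    simp only [tasoevTails, tasoevQuotient, hd, hm, hd', hm', one_div_one_div]

lemma tasoev_convergesTo {p u v : ℕ} {e f : ℚ} (hp : 1 < p) (hu : 1 < u) (hv : 1 < v)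
    (he : 1 ≤ (e : ℝ) * u) (hf : 1 ≤ (f : ℝ) * v) :
    (infContFrac 0 (tasoevQuotient p u v e f)).ConvergesTo
      (1 / (p : ℝ) + tasoevTail ((e : ℝ) * (p : ℝ) ^ 2) f u v) := by
  have hp0 : (0 : ℝ) < p := by exact_mod_cast one_pos.trans hp
  have hu1 : (1 : ℝ) < u := by exact_mod_cast hu
  have hv1 : (1 : ℝ) < v := by exact_mod_cast hv
  have hu0 := one_pos.trans hu1
  have hv0 := one_pos.trans hv1
  have he0 : (0 : ℝ) < e := pos_of_mul_pos_left (one_pos.trans_le he) hu0.le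
  have hf0 : (0 : ℝ) < f := pos_of_mul_pos_left (one_pos.trans_le hf) hv0.le
  have he' : ∀ j : ℕ, 1 ≤ (e : ℝ) * (u : ℝ) ^ (j + 1) := fun j => by
    rw [pow_succ', ← mul_assoc]
    exact one_le_mul_of_one_le_of_one_le he (one_le_pow₀ hu1.le)
  have hf' : ∀ j : ℕ, 1 ≤ (f : ℝ) * (v : ℝ) ^ (j + 1) := fun j => by
    rw [pow_succ', ← mul_assoc]
    exact one_le_mul_of_one_le_of_one_le hf (one_le_pow₀ hv1.le)
  set K : ℕ → ℝ := fun j =>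
    tasoevTail ((e : ℝ) * (p : ℝ) ^ 2 * (u : ℝ) ^ j) ((f : ℝ) * (v : ℝ) ^ j) u v with hKdef
  set L : ℕ → ℝ := fun j => 1 / ((f : ℝ) * (v : ℝ) ^ (j + 1) + K (j + 1)) with hLdef
  have hK : ∀ j, 0 < K j := fun j => tasoevTail_pos (by positivity) (by positivity) hu1 hv1
  have hL : ∀ j, 0 < L j := fun j =>
    one_div_pos.2 (add_pos (one_pos.trans_le (hf' j)) (hK (j + 1)))
  have hKL : ∀ j, K j = 1 / ((e : ℝ) * (p : ℝ) ^ 2 * (u : ℝ) ^ (j + 1) + L j) := fun j => by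
    simp only [hLdef, hKdef]
    rw [tasoevTail_rec (by positivity) (by positivity) hu1 hv1]
    simp only [pow_succ, mul_assoc]
  have hnn := tasoevQuotient_nonneg hp.le he' hf'
  have hsum : Tendsto (fun n => ∑ k ∈ Finset.range n, tasoevQuotient p u v e f k) atTop atTop := by
    rw [← not_summable_iff_tendsto_nat_atTop_of_nonneg hnn]
    intro h
    -- Some quotients may vanish (`e u - 1` can be `0`), but the constant ones at indices `6 j + 1`
    -- already force divergence.
    have h1 : Tendsto (fun j : ℕ => 6 * j + 1) atTop atTop :=
      tendsto_atTop_mono (fun j => by omega : ∀ j : ℕ, j ≤ 6 * j + 1) tendsto_id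
    have h2 := h.tendsto_atTop_zero.comp h1
    simp only [Function.comp_def, tasoevQuotient_six_mul_add_one] at h2
    exact one_ne_zero (tendsto_nhds_unique tendsto_const_nhds h2)
  have hb0 : 1 ≤ tasoevQuotient p u v e f 0 := by
    have : (2 : ℝ) ≤ p := by exact_mod_cast hp
    simp only [tasoevQuotient]
    linarith
  have hmain := infContFrac_convergesTo_of_tails _ _ hnn hb0 (tasoevTails_pos hp.le he' hf' hK hL)
    (tasoevTails_rec hp.le he' hf' hK hL hKL fun j => rfl) hsum
  simpa [tasoevTails, hKdef] using hmain

lemma denTerm_eq_qHypTerm (e f u v : ℝ) :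
    denTerm e f u v = qHypTerm (1 / (e * f)) (-1 / (e * f * u ^ 2 * v)) (1 / (u * v)) := by
  funext n
  simp only [denTerm, qHypTerm, one_div, inv_pow]

/-- The numerator series is thus the shifted `qHyp (a q) (c q) q` of `qHyp_sub_qHypTilt`. -/
lemma numTerm_eq_qHypTerm (e f u v : ℝ) :
    numTerm e f u v = qHypTerm (1 / (e * f) * (1 / (u * v)))
      (-1 / (e * f * u ^ 2 * v) * (1 / (u * v))) (1 / (u * v)) := by
  funext n
  have h : n * (n + 3) / 2 = n + n * (n + 1) / 2 := by
    rw [show n * (n + 3) = n * (n + 1) + n * 2 by ring, Nat.add_mul_div_right _ _ two_pos, add_comm]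
  have h' : -1 / (e * f * u ^ 2 * v) * (1 / (u * v)) = -1 / (e * f * u ^ 3 * v ^ 2) := by
    rw [div_mul_div_comm, mul_one]
    ring_nf
  simp only [numTerm, qHypTerm]
  rw [h, h', pow_add]
  simp only [one_div, mul_inv, mul_pow, inv_pow, mul_assoc]

theorem mainTheorem6 (p u v : ℕ) (hp : 1 < p) (hu : 1 < u) (hv : 1 < v) (e f : ℚ)
    (heu : ∃ k : ℕ, e * (u : ℚ) - 1 = (k : ℚ)) (hfv : ∃ k : ℕ, f * (v : ℚ) - 1 = (k : ℚ)) :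
    Summable (numTerm ((e : ℝ) * (p : ℝ) ^ 2) f u v) ∧
    Summable (denTerm ((e : ℝ) * (p : ℝ) ^ 2) f u v) ∧
    (∑' n : ℕ, denTerm ((e : ℝ) * (p : ℝ) ^ 2) f u v n) ≠ 0 ∧
    (infContFrac 0 (tasoevQuotient p u v e f)).ConvergesTo
      (1 / (p : ℝ) +
        (1 / ((e : ℝ) * (p : ℝ) ^ 2 * u) -
          1 / ((e : ℝ) ^ 2 * f * (p : ℝ) ^ 4 * (u : ℝ) ^ 2 * v + (e : ℝ) * (p : ℝ) ^ 2) *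
            ((∑' n : ℕ, numTerm ((e : ℝ) * (p : ℝ) ^ 2) f u v n) /
              (∑' n : ℕ, denTerm ((e : ℝ) * (p : ℝ) ^ 2) f u v n)))) := by
  have hp0 : (0 : ℝ) < p := by exact_mod_cast one_pos.trans hp
  have hu1 : (1 : ℝ) < u := by exact_mod_cast hu
  have hv1 : (1 : ℝ) < v := by exact_mod_cast hv
  have hu0 := one_pos.trans hu1
  have hv0 := one_pos.trans hv1
  have he : 1 ≤ (e : ℝ) * u := by
    obtain ⟨k, hk⟩ := heu
    have : (1 : ℚ) ≤ e * u := by linarith [(k.cast_nonneg : (0 : ℚ) ≤ k)]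
    exact_mod_cast this
  have hf : 1 ≤ (f : ℝ) * v := by
    obtain ⟨k, hk⟩ := hfv
    have : (1 : ℚ) ≤ f * v := by linarith [(k.cast_nonneg : (0 : ℚ) ≤ k)]
    exact_mod_cast this
  have he0 : (0 : ℝ) < e := pos_of_mul_pos_left (one_pos.trans_le he) hu0.le
  have hf0 : (0 : ℝ) < f := pos_of_mul_pos_left (one_pos.trans_le hf) hv0.le
  have hE : 0 < (e : ℝ) * (p : ℝ) ^ 2 := by positivity
  obtain ⟨ha, hc, hq, hq1⟩ := tasoev_params hE hf0 hu1 hv1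
  have hG := qHyp_pos ha hc hq hq1
  have hii := qHyp_sub_qHypTilt ha hc hq hq1
  have hconv := tasoev_convergesTo hp hu hv he hf
  rw [numTerm_eq_qHypTerm, denTerm_eq_qHypTerm]
  refine ⟨qHypTerm_summable (mul_pos ha hq) (mul_neg_of_neg_of_pos hc hq) hq hq1,
    qHypTerm_summable ha hc hq hq1, hG.ne', ?_⟩
  convert hconv using 2
  rw [← qHyp, ← qHyp, tasoevTail]
  generalize qHyp (1 / ((e : ℝ) * (p : ℝ) ^ 2 * f)) _ _ = G at *
  generalize qHyp _ _ _ = G' at *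
  generalize qHypTilt _ _ _ = P at *
  -- Writing `P / (E u G) = 1 / (E u) - (G - P) / (E u G)`, this relation replaces `G - P` by a
  -- multiple of `G'`.
  have h1 : ((e : ℝ) * (p : ℝ) ^ 2 * f * (u : ℝ) ^ 2 * v + 1) * (G - P) = u * G' := by
    field_simp at hii
    linear_combination hii
  rw [show (e : ℝ) ^ 2 * f * (p : ℝ) ^ 4 * (u : ℝ) ^ 2 * v + (e : ℝ) * (p : ℝ) ^ 2 =
    (e : ℝ) * (p : ℝ) ^ 2 * ((e : ℝ) * (p : ℝ) ^ 2 * f * (u : ℝ) ^ 2 * v + 1) by ring]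
  field_simp
  linear_combination h1
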